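/- For a real matrix $X\in\mathbb{R}^{m\times n}$ let $\sigma_1(X)\ge\dots\ge\sigma_{\min(m,n)}(X)\ge 0$ be its singular values, let $\|X\|_{\mathrm{tr}}=\sum_{i=1}^{\min(m,n)}\sigma_i(X)$ be its trace norm, and let $\|X\|_{S_{1/2}}=\bigl(\sum_{i=1}^{\min(m,n)}\sigma_i(X)^{1/2}\bigr)^2$ be its Schatten-$1/2$ quasi-norm. For an integer $d\ge\operatorname{rank}(X)$ the bi-trace norm of $X$ is $$\|X\|_{\mathrm{Bi\text{-}tr}}:=\min_{U\in\mathbb{R}^{m\times d},\,V\in\mathbb{R}^{n\times d}:\,X=UV^{T}}\|U\|_{\mathrm{tr}}\|V\|_{\mathrm{tr}}.$$ Theorem. Let $m,n$ be given. (1) The bi-trace norm is a quasi-norm: there is a constant $\alpha\ge 1$, depending only on $m$ and $n$, such that for every $d$ and all $X,Y\in\mathbb{R}^{m\times n}$ for which $X$, $Y$ and $X+Y$ have rank at most $d$, and every $a\in\mathbb{R}$: $\|X\|_{\mathrm{Bi\text{-}tr}}\ge 0$, with equality if and only if $X=0$; $\|aX\|_{\mathrm{Bi\text{-}tr}}=|a|\,\|X\|_{\mathrm{Bi\text{-}tr}}$;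 and $\|X+Y\|_{\mathrm{Bi\text{-}tr}}\le\alpha\bigl(\|X\|_{\mathrm{Bi\text{-}tr}}+\|Y\|_{\mathrm{Bi\text{-}tr}}\bigr)$. In particular, for $d\ge\min(m,n)$ it is a quasi-norm on the whole space $\mathbb{R}^{m\times n}$. (2) For every $d$ and every $X\in\mathbb{R}^{m\times n}$ with $\operatorname{rank}(X)\le d$, the minimum defining $\|X\|_{\mathrm{Bi\text{-}tr}}$ is attained, $\|X\|_{\mathrm{Bi\text{-}tr}}=\|X\|_{S_{1/2}}$, and $$\|X\|_{\mathrm{Bi\text{-}tr}}=\min_{X=UV^{T}}\frac{\|U\|_{\mathrm{tr}}^2+\|V\|_{\mathrm{tr}}^2}{2}=\min_{X=UV^{T}}\left(\frac{\|U\|_{\mathrm{tr}}+\|V\|_{\mathrm{tr}}}{2}\right)^2,$$ where both minima are over $U\in\mathbb{R}^{m\times d}$, $V\in\mathbb{R}^{n\times d}$ and are attained. -/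

import Mathlib

noncomputable section

/-- `matrixSingularValue X i` is the `i`-th (counted from `0`, in decreasing order) singular value
of the real matrix `X`, acting between Euclidean spaces. -/
def matrixSingularValue {m n : ℕ} (X : Matrix (Fin m) (Fin n) ℝ) (i : ℕ) : ℝ :=
  (Matrix.toEuclideanLin X).singularValues i

/-- The trace (nuclear) norm: the sum of the singular values. -/
def traceNorm {m n : ℕ} (X : Matrix (Fin m) (Fin n) ℝ) : ℝ :=
  ∑ i ∈ Finset.range (min m n), matrixSingularValue X i

/-- The Schatten-`p` (quasi-)norm `(∑ σᵢ(X) ^ p) ^ (1 / p)`, for `0 < p`. -/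
def schattenNorm (p : ℝ) {m n : ℕ} (X : Matrix (Fin m) (Fin n) ℝ) : ℝ :=
  (∑ i ∈ Finset.range (min m n), matrixSingularValue X i ^ p) ^ (1 / p)

/-- The bi-trace norm of `X` with inner dimension `d`: the infimum of `‖U‖_tr * ‖V‖_tr` over all
factorizations `X = U Vᵀ` with `U` of size `m × d` and `V` of size `n × d`. It is meant for
`X.rank ≤ d`; that the infimum is then a minimum is part of the theorem. -/
def biTraceNorm (d : ℕ) {m n : ℕ} (X : Matrix (Fin m) (Fin n) ℝ) : ℝ :=
  sInf {t : ℝ | ∃ (U : Matrix (Fin m) (Fin d) ℝ) (V : Matrix (Fin n) (Fin d) ℝ),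
    X = U * V.transpose ∧ t = traceNorm U * traceNorm V}

/-- `N` satisfies the axioms of a quasi-norm, with constant `α` in the quasi-triangle inequality,
at the elements of the set `S`. For `S = Set.univ` this says that `N` is a quasi-norm on `E`. -/
structure IsQuasiNormOn {E : Type*} [AddCommGroup E] [Module ℝ E] (α : ℝ) (S : Set E)
    (N : E → ℝ) : Prop where
  nonneg : ∀ x ∈ S, 0 ≤ N x
  eq_zero_iff : ∀ x ∈ S, N x = 0 ↔ x = 0
  smul : ∀ (a : ℝ), ∀ x ∈ S, a • x ∈ S ∧ N (a • x) = |a| * N x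
  add_le : ∀ x ∈ S, ∀ y ∈ S, x + y ∈ S → N (x + y) ≤ α * (N x + N y)

end

/-!
If `X = A B*` has singular vectors `uᵢ`, `vᵢ`, then the families `A* uᵢ` and `B* vᵢ` are
biorthogonal with pairings `σᵢ(X)`. Orthonormalizing the second family by Gram–Schmidt produces
`eᵢ` with `σᵢ(X) = ⟪uᵢ, A eᵢ⟫ ⟪B eᵢ, vᵢ⟫`. Cauchy–Schwarz and the bound of diagonal sums by the
nuclear norm then give Hölder's inequality `(∑ √σᵢ(X))² ≤ ‖A‖_tr ‖B‖_tr`. Splitting the singular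
values evenly between the two factors gives equality, which settles all three minima by AM–GM.

Consequently `‖X‖_{1/2}` is also the minimum of `(∑ ‖aᵢ‖) (∑ ‖bᵢ‖)` over all expansions
`X = ∑ aᵢ bᵢ*` into rank-one maps. Concatenating optimal expansions of `X` and `Y` shows that
`√‖·‖_{1/2}` is subadditive, so the constant in the quasi-triangle inequality is `2`.
-/

open Module InnerProductSpace

section RankOneSum

variable {𝕜 E F G ι κ : Type*} [RCLike 𝕜] [Fintype ι] [Fintype κ]
  [NormedAddCommGroup E] [InnerProductSpace 𝕜 E] [NormedAddCommGroup F] [InnerProductSpace 𝕜 F]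
  [NormedAddCommGroup G] [InnerProductSpace 𝕜 G]

variable (𝕜) in
/-- The map `x ↦ ∑ i, ⟪b i, x⟫ • a i`, a sum of rank-one maps. Expansions `T = rankOneSum 𝕜 a b`
into arbitrary vectors are compared with the singular value decomposition of `T`. -/
noncomputable def rankOneSum (a : ι → F) (b : ι → E) : E →ₗ[𝕜] F :=
  ∑ i, (rankOne 𝕜 (a i) (b i)).toLinearMap

theorem rankOneSum_apply (a : ι → F) (b : ι → E) (x : E) :
    rankOneSum 𝕜 a b x = ∑ i, inner 𝕜 (b i) x • a i := by
  simp [rankOneSum]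

theorem inner_rankOneSum_apply (a : ι → F) (b : ι → E) (y : F) (x : E) :
    inner 𝕜 y (rankOneSum 𝕜 a b x) = ∑ i, inner 𝕜 y (a i) * inner 𝕜 (b i) x := by
  simp [rankOneSum_apply, inner_sum, inner_smul_right, mul_comm]

theorem rankOneSum_apply_of_orthonormal (a : ι → F) {b : ι → E} (hb : Orthonormal 𝕜 b) (i : ι) :
    rankOneSum 𝕜 a b (b i) = a i := by
  classical
  simp [rankOneSum_apply, orthonormal_iff_ite.1 hb]

theorem adjoint_rankOneSum [FiniteDimensional 𝕜 E] [FiniteDimensional 𝕜 F]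
    (a : ι → F) (b : ι → E) :
    LinearMap.adjoint (rankOneSum 𝕜 a b) = rankOneSum 𝕜 b a := by
  refine ((LinearMap.eq_adjoint_iff _ _).2 fun y x => ?_).symm
  simp [rankOneSum_apply, sum_inner, inner_sum, inner_smul_left, inner_smul_right, mul_comm]

theorem rankOneSum_comp_rankOneSum {e : ι → G} (he : Orthonormal 𝕜 e) (a : ι → F) (b : ι → E) :
    rankOneSum 𝕜 a e ∘ₗ rankOneSum 𝕜 e b = rankOneSum 𝕜 a b := by
  ext x
  simp only [LinearMap.comp_apply, rankOneSum_apply _ b, map_sum, map_smul,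
    rankOneSum_apply_of_orthonormal _ he]

theorem rankOneSum_sumElim (a : ι → F) (b : ι → E) (a' : κ → F) (b' : κ → E) :
    rankOneSum 𝕜 (Sum.elim a a') (Sum.elim b b') = rankOneSum 𝕜 a b + rankOneSum 𝕜 a' b' := by
  simp [rankOneSum]

theorem rankOneSum_smul (c : 𝕜) (a : ι → F) (b : ι → E) :
    rankOneSum 𝕜 (c • a) b = c • rankOneSum 𝕜 a b := by
  ext x
  simp [rankOneSum_apply, Finset.smul_sum, smul_comm c]

theorem sum_norm_inner_mul_norm_inner_le {f : κ → F} {g : κ → E}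
    (hf : Orthonormal 𝕜 f) (hg : Orthonormal 𝕜 g) (a : F) (b : E) :
    ∑ k, ‖inner 𝕜 (f k) a‖ * ‖inner 𝕜 (g k) b‖ ≤ ‖a‖ * ‖b‖ :=
  calc ∑ k, ‖inner 𝕜 (f k) a‖ * ‖inner 𝕜 (g k) b‖
      ≤ √(∑ k, ‖inner 𝕜 (f k) a‖ ^ 2) * √(∑ k, ‖inner 𝕜 (g k) b‖ ^ 2) :=
        Real.sum_mul_le_sqrt_mul_sqrt _ _ _
    _ ≤ ‖a‖ * ‖b‖ := by
        gcongr
        · exact Real.sqrt_le_left (norm_nonneg a) |>.2 (hf.sum_inner_products_le a)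
        · exact Real.sqrt_le_left (norm_nonneg b) |>.2 (hg.sum_inner_products_le b)

theorem sum_norm_inner_rankOneSum_le (a : ι → F) (b : ι → E) {f : κ → F} {g : κ → E}
    (hf : Orthonormal 𝕜 f) (hg : Orthonormal 𝕜 g) :
    ∑ k, ‖inner 𝕜 (f k) (rankOneSum 𝕜 a b (g k))‖ ≤ ∑ i, ‖a i‖ * ‖b i‖ :=
  calc ∑ k, ‖inner 𝕜 (f k) (rankOneSum 𝕜 a b (g k))‖
      ≤ ∑ k, ∑ i, ‖inner 𝕜 (f k) (a i)‖ * ‖inner 𝕜 (g k) (b i)‖ := by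
        gcongr with k
        rw [inner_rankOneSum_apply]
        refine (norm_sum_le _ _).trans_eq ?_
        simp only [norm_mul, norm_inner_symm (b _)]
    _ = ∑ i, ∑ k, ‖inner 𝕜 (f k) (a i)‖ * ‖inner 𝕜 (g k) (b i)‖ := Finset.sum_comm
    _ ≤ ∑ i, ‖a i‖ * ‖b i‖ :=
        Finset.sum_le_sum fun i _ => sum_norm_inner_mul_norm_inner_le hf hg (a i) (b i)

end RankOneSum

section GramSchmidt

variable {𝕜 E ι : Type*} [RCLike 𝕜] [NormedAddCommGroup E] [InnerProductSpace 𝕜 E]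
  [LinearOrder ι] [LocallyFiniteOrderBot ι] [WellFoundedLT ι]

theorem inner_gramSchmidt_eq_of_forall_lt {a : E} {b : ι → E} {i : ι}
    (h : ∀ j < i, inner 𝕜 a (b j) = 0) : inner 𝕜 a (gramSchmidt 𝕜 b i) = inner 𝕜 a (b i) := by
  have hspan : Submodule.span 𝕜 (gramSchmidt 𝕜 b '' Set.Iio i) ≤ (𝕜 ∙ a)ᗮ := by
    rw [span_gramSchmidt_Iio, Submodule.span_le]
    rintro _ ⟨j, hj, rfl⟩
    exact Submodule.mem_orthogonal_singleton_iff_inner_right.2 (h j hj)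
  have horth (j) (hj : j ∈ Finset.Iio i) : inner 𝕜 a (gramSchmidt 𝕜 b j) = 0 :=
    Submodule.mem_orthogonal_singleton_iff_inner_right.1
      (hspan (Submodule.subset_span ⟨j, Finset.mem_Iio.1 hj, rfl⟩))
  rw [gramSchmidt_def'' 𝕜 b i, inner_add_right, inner_sum, Finset.sum_eq_zero, add_zero]
  intro j hj
  rw [inner_smul_right, horth j hj, mul_zero]

theorem exists_orthonormal_inner_mul_inner_eq {a b : ι → E} (hdiag : ∀ i, inner 𝕜 (a i) (b i) ≠ 0)
    (hlt : ∀ i, ∀ j < i, inner 𝕜 (a i) (b j) = 0) :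
    ∃ e : ι → E, Orthonormal 𝕜 e ∧
      ∀ i, inner 𝕜 (a i) (e i) * inner 𝕜 (e i) (b i) = inner 𝕜 (a i) (b i) := by
  set g := gramSchmidt 𝕜 b
  have hag (i) : inner 𝕜 (a i) (g i) = inner 𝕜 (a i) (b i) :=
    inner_gramSchmidt_eq_of_forall_lt (hlt i)
  have hgb (i) : inner 𝕜 (g i) (b i) = inner 𝕜 (g i) (g i) :=
    (inner_gramSchmidt_eq_of_forall_lt fun j hj => gramSchmidt_inv_triangular 𝕜 b hj).symm
  have hg (i) : g i ≠ 0 := fun h0 => hdiag i (by rw [← hag, h0, inner_zero_right])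
  refine ⟨gramSchmidtNormed 𝕜 b, ⟨fun i => norm_smul_inv_norm (hg i), fun i j hij => ?_⟩,
    fun i => ?_⟩
  · simp [gramSchmidtNormed, inner_smul_left, inner_smul_right, gramSchmidt_orthogonal 𝕜 b hij]
  · have hnorm : (‖g i‖ : 𝕜) ≠ 0 := by simpa using hg i
    change inner 𝕜 (a i) ((‖g i‖ : 𝕜)⁻¹ • g i) * inner 𝕜 ((‖g i‖ : 𝕜)⁻¹ • g i) (b i) = _
    rw [inner_smul_right, inner_smul_left, hag, hgb, inner_self_eq_norm_sq_to_K, map_inv₀,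
      RCLike.conj_ofReal]
    field_simp

end GramSchmidt

section SingularValues

variable {𝕜 E F G ι κ : Type*} [RCLike 𝕜] [Fintype ι] [Fintype κ]
  [NormedAddCommGroup E] [InnerProductSpace 𝕜 E] [FiniteDimensional 𝕜 E]
  [NormedAddCommGroup F] [InnerProductSpace 𝕜 F] [FiniteDimensional 𝕜 F]
  [NormedAddCommGroup G] [InnerProductSpace 𝕜 G] [FiniteDimensional 𝕜 G]

theorem inner_apply_eigenvectorBasis_adjoint_comp_self (T : E →ₗ[𝕜] F)
    (i j : Fin (finrank 𝕜 E)) :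
    inner 𝕜 (T (T.isSymmetric_adjoint_comp_self.eigenvectorBasis rfl i))
      (T (T.isSymmetric_adjoint_comp_self.eigenvectorBasis rfl j)) =
        if i = j then (T.singularValues j : 𝕜) ^ 2 else 0 := by
  rw [← LinearMap.adjoint_inner_right, ← LinearMap.comp_apply,
    LinearMap.IsSymmetric.apply_eigenvectorBasis, ← T.sq_singularValues_fin rfl, inner_smul_right,
    orthonormal_iff_ite.1 (OrthonormalBasis.orthonormal _)]
  simp

theorem exists_orthonormal_eq_rankOneSum_singularValues (T : E →ₗ[𝕜] F) :
    ∃ (u : Fin (finrank 𝕜 T.range) → F) (v : Fin (finrank 𝕜 T.range) → E),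
      Orthonormal 𝕜 u ∧ Orthonormal 𝕜 v ∧
        T = rankOneSum 𝕜 (fun i : Fin (finrank 𝕜 T.range) => (T.singularValues i : 𝕜) • u i) v := by
  set b := T.isSymmetric_adjoint_comp_self.eigenvectorBasis rfl
  have hTb := inner_apply_eigenvectorBasis_adjoint_comp_self T
  let ι := Fin.castLE T.finrank_range_le
  have hne (i : Fin (finrank 𝕜 T.range)) : (T.singularValues i : 𝕜) ≠ 0 :=
    mod_cast (T.singularValues_pos_iff_lt_finrank_range.2 i.2).ne'
  have hker (j) (hj : j ∉ Set.range ι) : T (b j) = 0 := by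
    have hj' : finrank 𝕜 T.range ≤ j := not_lt.1 fun hlt => hj ⟨⟨j, hlt⟩, rfl⟩
    rw [← inner_self_eq_zero (𝕜 := 𝕜), hTb, if_pos rfl,
      T.singularValues_eq_zero_iff_le_finrank_range.2 hj']
    simp
  refine ⟨fun i => (T.singularValues i : 𝕜)⁻¹ • T (b (ι i)), b ∘ ι, ?_,
    b.orthonormal.comp _ (Fin.castLE_injective _), ?_⟩
  · refine orthonormal_iff_ite.2 fun i j => ?_
    rw [inner_smul_left, inner_smul_right, hTb, map_inv₀, RCLike.conj_ofReal]
    rcases eq_or_ne i j with rfl | hij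
    · rw [if_pos rfl, if_pos rfl, Fin.val_castLE, sq, inv_mul_cancel_left₀ (hne i),
        inv_mul_cancel₀ (hne i)]
    · rw [if_neg ((Fin.castLE_injective _).ne hij), if_neg hij, mul_zero, mul_zero]
  · ext x
    calc T x = ∑ j, inner 𝕜 (b j) x • T (b j) := by
          conv_lhs => rw [← b.sum_repr' x, map_sum]
          simp only [map_smul]
      _ = ∑ i, inner 𝕜 (b (ι i)) x • T (b (ι i)) :=
          (Fintype.sum_of_injective ι (Fin.castLE_injective _) _ _
            (fun j hj => by rw [hker j hj, smul_zero]) fun _ => rfl).symm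
      _ = _ := by simp only [rankOneSum_apply, smul_inv_smul₀ (hne _), Function.comp_apply]

/-- The nuclear norm of a linear map, as the sum of its nonzero singular values. It is the
coordinate-free form of `traceNorm`. -/
noncomputable def nuclearNorm (T : E →ₗ[𝕜] F) : ℝ :=
  ∑ i : Fin (finrank 𝕜 T.range), T.singularValues i

/-- The Schatten-`1/2` quasi-norm of a linear map, computed from its nonzero singular values. It is
the coordinate-free form of `schattenNorm (1 / 2)`. -/
noncomputable def schattenHalf (T : E →ₗ[𝕜] F) : ℝ :=
  (∑ i : Fin (finrank 𝕜 T.range), √(T.singularValues i)) ^ 2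

theorem nuclearNorm_nonneg (T : E →ₗ[𝕜] F) : 0 ≤ nuclearNorm T :=
  Finset.sum_nonneg fun i _ => T.singularValues_nonneg i

theorem schattenHalf_nonneg (T : E →ₗ[𝕜] F) : 0 ≤ schattenHalf T :=
  sq_nonneg _

theorem sqrt_schattenHalf (T : E →ₗ[𝕜] F) :
    √(schattenHalf T) = ∑ i : Fin (finrank 𝕜 T.range), √(T.singularValues i) :=
  Real.sqrt_sq (Finset.sum_nonneg fun _ _ => Real.sqrt_nonneg _)

theorem sum_norm_inner_apply_le_nuclearNorm (T : E →ₗ[𝕜] F) {f : κ → F} {g : κ → E}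
    (hf : Orthonormal 𝕜 f) (hg : Orthonormal 𝕜 g) :
    ∑ k, ‖inner 𝕜 (f k) (T (g k))‖ ≤ nuclearNorm T := by
  obtain ⟨u, v, hu, hv, hT⟩ := exists_orthonormal_eq_rankOneSum_singularValues T
  have hle := sum_norm_inner_rankOneSum_le
    (fun i : Fin (finrank 𝕜 T.range) => (T.singularValues i : 𝕜) • u i) v hf hg
  rw [← hT] at hle
  simpa [nuclearNorm, norm_smul, hu.1, hv.1, abs_of_nonneg (T.singularValues_nonneg _)] using hle

theorem exists_orthonormal_inner_apply_eq_singularValues (T : E →ₗ[𝕜] F) :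
    ∃ (u : Fin (finrank 𝕜 T.range) → F) (v : Fin (finrank 𝕜 T.range) → E),
      Orthonormal 𝕜 u ∧ Orthonormal 𝕜 v ∧
        ∀ i j, inner 𝕜 (u i) (T (v j)) = if i = j then (T.singularValues j : 𝕜) else 0 := by
  obtain ⟨u, v, hu, hv, hT⟩ := exists_orthonormal_eq_rankOneSum_singularValues T
  refine ⟨u, v, hu, hv, fun i j => ?_⟩
  have hTv : T (v j) = (T.singularValues j : 𝕜) • u j := by
    conv_lhs => rw [hT, rankOneSum_apply_of_orthonormal _ hv]
  rw [hTv, inner_smul_right, orthonormal_iff_ite.1 hu, mul_ite, mul_one, mul_zero]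

theorem nuclearNorm_rankOneSum_le (a : ι → F) (b : ι → E) :
    nuclearNorm (rankOneSum 𝕜 a b) ≤ ∑ i, ‖a i‖ * ‖b i‖ := by
  obtain ⟨u, v, hu, hv, huv⟩ :=
    exists_orthonormal_inner_apply_eq_singularValues (rankOneSum 𝕜 a b)
  simpa [nuclearNorm, huv, abs_of_nonneg (LinearMap.singularValues_nonneg _ _)]
    using sum_norm_inner_rankOneSum_le a b hu hv

theorem schattenHalf_comp_adjoint_le (A : G →ₗ[𝕜] F) (B : G →ₗ[𝕜] E) :
    schattenHalf (A ∘ₗ LinearMap.adjoint B) ≤ nuclearNorm A * nuclearNorm B := by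
  set X := A ∘ₗ LinearMap.adjoint B with hX
  obtain ⟨u, v, hu, hv, huv⟩ := exists_orthonormal_inner_apply_eq_singularValues X
  have hpair (i j) : inner 𝕜 (LinearMap.adjoint A (u i)) (LinearMap.adjoint B (v j)) =
      if i = j then (X.singularValues j : 𝕜) else 0 := by
    rw [LinearMap.adjoint_inner_left, ← huv, hX, LinearMap.comp_apply]
  obtain ⟨e, he, hfactor⟩ := exists_orthonormal_inner_mul_inner_eq
    (a := fun i => LinearMap.adjoint A (u i)) (b := fun i => LinearMap.adjoint B (v i))
    (fun i => by
      rw [hpair, if_pos rfl]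
      exact mod_cast (X.singularValues_pos_iff_lt_finrank_range.2 i.2).ne')
    (fun i j hj => by rw [hpair, if_neg hj.ne'])
  have hσ (i : Fin (finrank 𝕜 X.range)) :
      X.singularValues i = ‖inner 𝕜 (u i) (A (e i))‖ * ‖inner 𝕜 (v i) (B (e i))‖ := by
    have := congrArg norm (hfactor i)
    rw [hpair, if_pos rfl, RCLike.norm_ofReal, abs_of_nonneg (X.singularValues_nonneg i), norm_mul,
      LinearMap.adjoint_inner_left, LinearMap.adjoint_inner_right] at this
    rw [← this, norm_inner_symm (v i)]
  calc schattenHalf X ≤ (∑ i, ‖inner 𝕜 (u i) (A (e i))‖) * ∑ i, ‖inner 𝕜 (v i) (B (e i))‖ :=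
        Finset.sum_sq_le_sum_mul_sum_of_sq_le_mul _ (fun _ _ => norm_nonneg _)
          (fun _ _ => norm_nonneg _)
          fun i _ => by rw [Real.sq_sqrt (X.singularValues_nonneg i), hσ]
    _ ≤ nuclearNorm A * nuclearNorm B :=
        mul_le_mul (sum_norm_inner_apply_le_nuclearNorm A hu he)
          (sum_norm_inner_apply_le_nuclearNorm B hv he)
          (Finset.sum_nonneg fun _ _ => norm_nonneg _) (nuclearNorm_nonneg A)

theorem exists_comp_adjoint_eq_rankOneSum {e : ι → G} (he : Orthonormal 𝕜 e)
    (a : ι → F) (b : ι → E) :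
    ∃ (A : G →ₗ[𝕜] F) (B : G →ₗ[𝕜] E), rankOneSum 𝕜 a b = A ∘ₗ LinearMap.adjoint B ∧
      nuclearNorm A ≤ ∑ i, ‖a i‖ ∧ nuclearNorm B ≤ ∑ i, ‖b i‖ := by
  refine ⟨rankOneSum 𝕜 a e, rankOneSum 𝕜 b e, ?_, ?_, ?_⟩
  · rw [adjoint_rankOneSum, rankOneSum_comp_rankOneSum he]
  · simpa [he.1] using nuclearNorm_rankOneSum_le (𝕜 := 𝕜) a e
  · simpa [he.1] using nuclearNorm_rankOneSum_le (𝕜 := 𝕜) b e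

theorem schattenHalf_rankOneSum_le (a : ι → F) (b : ι → E) :
    schattenHalf (rankOneSum 𝕜 a b) ≤ (∑ i, ‖a i‖) * ∑ i, ‖b i‖ := by
  obtain ⟨A, B, hAB, hA, hB⟩ := exists_comp_adjoint_eq_rankOneSum
    (EuclideanSpace.basisFun ι 𝕜).orthonormal a b
  rw [hAB]
  exact (schattenHalf_comp_adjoint_le A B).trans
    (mul_le_mul hA hB (nuclearNorm_nonneg B) (Finset.sum_nonneg fun _ _ => norm_nonneg _))

theorem exists_eq_rankOneSum_sum_norm_eq_sqrt_schattenHalf (T : E →ₗ[𝕜] F) :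
    ∃ (a : Fin (finrank 𝕜 T.range) → F) (b : Fin (finrank 𝕜 T.range) → E),
      T = rankOneSum 𝕜 a b ∧
        ∑ i, ‖a i‖ = √(schattenHalf T) ∧ ∑ i, ‖b i‖ = √(schattenHalf T) := by
  obtain ⟨u, v, hu, hv, hT⟩ := exists_orthonormal_eq_rankOneSum_singularValues T
  let s (i : Fin (finrank 𝕜 T.range)) : 𝕜 := √(T.singularValues i)
  have hs (i) : ‖s i‖ = √(T.singularValues i) := RCLike.norm_of_nonneg (Real.sqrt_nonneg _)
  have hss (i) : starRingEnd 𝕜 (s i) * s i = T.singularValues i := by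
    rw [RCLike.conj_ofReal, ← RCLike.ofReal_mul, Real.mul_self_sqrt (T.singularValues_nonneg i)]
  refine ⟨fun i => s i • u i, fun i => s i • v i, ?_, ?_, ?_⟩
  · conv_lhs => rw [hT]
    ext x
    simp only [rankOneSum_apply, inner_smul_left, smul_smul, ← hss, mul_left_comm, mul_comm]
  · simp [sqrt_schattenHalf, norm_smul, hs, hu.1]
  · simp [sqrt_schattenHalf, norm_smul, hs, hv.1]

theorem exists_comp_adjoint_eq_nuclearNorm_le_sqrt_schattenHalf (T : E →ₗ[𝕜] F)
    (hT : finrank 𝕜 T.range ≤ finrank 𝕜 G) :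
    ∃ (A : G →ₗ[𝕜] F) (B : G →ₗ[𝕜] E), T = A ∘ₗ LinearMap.adjoint B ∧
      nuclearNorm A ≤ √(schattenHalf T) ∧ nuclearNorm B ≤ √(schattenHalf T) := by
  obtain ⟨a, b, hab, ha, hb⟩ := exists_eq_rankOneSum_sum_norm_eq_sqrt_schattenHalf T
  have he := (stdOrthonormalBasis 𝕜 G).orthonormal.comp _ (Fin.castLE_injective hT)
  obtain ⟨A, B, hAB, hA, hB⟩ := exists_comp_adjoint_eq_rankOneSum he a b
  exact ⟨A, B, hab.trans hAB, hA.trans_eq ha, hB.trans_eq hb⟩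

theorem schattenHalf_eq_zero_iff {T : E →ₗ[𝕜] F} : schattenHalf T = 0 ↔ T = 0 := by
  refine ⟨fun h => ?_, fun h => by simp [schattenHalf, h]⟩
  obtain ⟨a, b, hab, ha, -⟩ := exists_eq_rankOneSum_sum_norm_eq_sqrt_schattenHalf T
  rw [h, Real.sqrt_zero, Finset.sum_eq_zero_iff_of_nonneg fun _ _ => norm_nonneg _] at ha
  have ha0 (i) : a i = 0 := norm_eq_zero.1 (ha i (Finset.mem_univ i))
  simp [hab, rankOneSum, ha0]

theorem schattenHalf_smul_le (c : 𝕜) (T : E →ₗ[𝕜] F) :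
    schattenHalf (c • T) ≤ ‖c‖ * schattenHalf T := by
  obtain ⟨a, b, hab, ha, hb⟩ := exists_eq_rankOneSum_sum_norm_eq_sqrt_schattenHalf T
  calc schattenHalf (c • T) = schattenHalf (rankOneSum 𝕜 (c • a) b) := by
        rw [rankOneSum_smul, ← hab]
    _ ≤ (∑ i, ‖(c • a) i‖) * ∑ i, ‖b i‖ := schattenHalf_rankOneSum_le _ _
    _ = ‖c‖ * schattenHalf T := by
        simp only [Pi.smul_apply, norm_smul, ← Finset.mul_sum]
        rw [ha, hb, mul_assoc, Real.mul_self_sqrt (schattenHalf_nonneg T)]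

theorem schattenHalf_smul (c : 𝕜) (T : E →ₗ[𝕜] F) :
    schattenHalf (c • T) = ‖c‖ * schattenHalf T := by
  rcases eq_or_ne c 0 with rfl | hc
  · simp [schattenHalf_eq_zero_iff]
  refine (schattenHalf_smul_le c T).antisymm ?_
  have hinv := schattenHalf_smul_le c⁻¹ (c • T)
  rwa [inv_smul_smul₀ hc, norm_inv, ← div_eq_inv_mul, le_div_iff₀' (norm_pos_iff.2 hc)] at hinv

theorem sqrt_schattenHalf_add_le (S T : E →ₗ[𝕜] F) :
    √(schattenHalf (S + T)) ≤ √(schattenHalf S) + √(schattenHalf T) := by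
  obtain ⟨a, b, hab, ha, hb⟩ := exists_eq_rankOneSum_sum_norm_eq_sqrt_schattenHalf S
  obtain ⟨a', b', hab', ha', hb'⟩ := exists_eq_rankOneSum_sum_norm_eq_sqrt_schattenHalf T
  refine Real.sqrt_le_iff.2 ⟨by positivity, ?_⟩
  calc schattenHalf (S + T)
      = schattenHalf (rankOneSum 𝕜 (Sum.elim a a') (Sum.elim b b')) := by
        rw [rankOneSum_sumElim, ← hab, ← hab']
    _ ≤ (∑ i, ‖Sum.elim a a' i‖) * ∑ i, ‖Sum.elim b b' i‖ := schattenHalf_rankOneSum_le _ _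
    _ = (√(schattenHalf S) + √(schattenHalf T)) ^ 2 := by
        simp only [Fintype.sum_sum_type, Sum.elim_inl, Sum.elim_inr, ha, hb, ha', hb', sq]

theorem schattenHalf_add_le (S T : E →ₗ[𝕜] F) :
    schattenHalf (S + T) ≤ 2 * (schattenHalf S + schattenHalf T) :=
  calc schattenHalf (S + T) ≤ (√(schattenHalf S) + √(schattenHalf T)) ^ 2 :=
        (Real.sqrt_le_left (by positivity)).1 (sqrt_schattenHalf_add_le S T)
    _ ≤ 2 * (√(schattenHalf S) ^ 2 + √(schattenHalf T) ^ 2) := add_sq_le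
    _ = 2 * (schattenHalf S + schattenHalf T) := by
        rw [Real.sq_sqrt (schattenHalf_nonneg S), Real.sq_sqrt (schattenHalf_nonneg T)]

end SingularValues

section Matrix

variable {m n d : ℕ}

theorem finrank_range_toEuclideanLin (X : Matrix (Fin m) (Fin n) ℝ) :
    finrank ℝ (Matrix.toEuclideanLin X).range = X.rank :=
  (X.rank_eq_finrank_range_toLin (PiLp.basisFun _ _ _) (PiLp.basisFun _ _ _)).symm

theorem toEuclideanLin_mul_transpose (U : Matrix (Fin m) (Fin d) ℝ)
    (V : Matrix (Fin n) (Fin d) ℝ) :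
    Matrix.toEuclideanLin (U * V.transpose) =
      Matrix.toEuclideanLin U ∘ₗ LinearMap.adjoint (Matrix.toEuclideanLin V) := by
  rw [← Matrix.toEuclideanLin_conjTranspose_eq_adjoint,
    Matrix.conjTranspose_eq_transpose_of_trivial]
  exact Matrix.toLpLin_mul_same _ _ _

theorem rank_le_min (X : Matrix (Fin m) (Fin n) ℝ) : X.rank ≤ min m n :=
  le_min X.rank_le_height X.rank_le_width

theorem sum_range_min_matrixSingularValue (X : Matrix (Fin m) (Fin n) ℝ) {f : ℝ → ℝ}
    (hf : f 0 = 0) :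
    ∑ i ∈ Finset.range (min m n), f (matrixSingularValue X i) =
      ∑ i : Fin (finrank ℝ (Matrix.toEuclideanLin X).range),
        f ((Matrix.toEuclideanLin X).singularValues i) := by
  rw [Fin.sum_univ_eq_sum_range (fun i => f ((Matrix.toEuclideanLin X).singularValues i))]
  refine (Finset.sum_subset ?_ fun i _ hi => ?_).symm
  · rw [Finset.range_subset_range, finrank_range_toEuclideanLin]
    exact rank_le_min X
  · rw [matrixSingularValue,
      (LinearMap.singularValues_eq_zero_iff_le_finrank_range _).2 (by simpa using hi), hf]

theorem traceNorm_eq_nuclearNorm (X : Matrix (Fin m) (Fin n) ℝ) :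
    traceNorm X = nuclearNorm (Matrix.toEuclideanLin X) :=
  sum_range_min_matrixSingularValue X (f := id) rfl

theorem schattenNorm_half_eq_schattenHalf (X : Matrix (Fin m) (Fin n) ℝ) :
    schattenNorm (1 / 2) X = schattenHalf (Matrix.toEuclideanLin X) := by
  rw [schattenHalf, ← sum_range_min_matrixSingularValue X Real.sqrt_zero]
  simp only [schattenNorm, ← Real.sqrt_eq_rpow]
  norm_num

theorem schattenNorm_half_mul_transpose_le (U : Matrix (Fin m) (Fin d) ℝ)
    (V : Matrix (Fin n) (Fin d) ℝ) :
    schattenNorm (1 / 2) (U * V.transpose) ≤ traceNorm U * traceNorm V := by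
  rw [schattenNorm_half_eq_schattenHalf, traceNorm_eq_nuclearNorm, traceNorm_eq_nuclearNorm,
    toEuclideanLin_mul_transpose]
  exact schattenHalf_comp_adjoint_le _ _

theorem exists_eq_mul_transpose_traceNorm_eq_sqrt_schattenNorm_half
    {X : Matrix (Fin m) (Fin n) ℝ} (hX : X.rank ≤ d) :
    ∃ (U : Matrix (Fin m) (Fin d) ℝ) (V : Matrix (Fin n) (Fin d) ℝ), X = U * V.transpose ∧
      traceNorm U = √(schattenNorm (1 / 2) X) ∧ traceNorm V = √(schattenNorm (1 / 2) X) := by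
  obtain ⟨A, B, hAB, hA, hB⟩ := exists_comp_adjoint_eq_nuclearNorm_le_sqrt_schattenHalf
    (G := EuclideanSpace ℝ (Fin d)) (Matrix.toEuclideanLin X)
    (by rwa [finrank_range_toEuclideanLin, finrank_euclideanSpace_fin])
  have hprod : √(schattenHalf (Matrix.toEuclideanLin X)) ^ 2 ≤ nuclearNorm A * nuclearNorm B := by
    rw [Real.sq_sqrt (schattenHalf_nonneg _), hAB]
    exact schattenHalf_comp_adjoint_le A B
  have hA0 := nuclearNorm_nonneg A
  have hB0 := nuclearNorm_nonneg B
  obtain ⟨U, rfl⟩ := Matrix.toEuclideanLin.surjective A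
  obtain ⟨V, rfl⟩ := Matrix.toEuclideanLin.surjective B
  rw [← toEuclideanLin_mul_transpose] at hAB
  refine ⟨U, V, Matrix.toEuclideanLin.injective hAB, ?_⟩
  rw [schattenNorm_half_eq_schattenHalf, traceNorm_eq_nuclearNorm, traceNorm_eq_nuclearNorm]
  exact ⟨hA.antisymm (by nlinarith), hB.antisymm (by nlinarith)⟩

theorem isLeast_schattenNorm_half {X : Matrix (Fin m) (Fin n) ℝ} (hX : X.rank ≤ d)
    {f : ℝ → ℝ → ℝ} (hf : ∀ x y, x * y ≤ f x y) (hdiag : ∀ x, f x x = x ^ 2) :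
    IsLeast {t : ℝ | ∃ (U : Matrix (Fin m) (Fin d) ℝ) (V : Matrix (Fin n) (Fin d) ℝ),
      X = U * V.transpose ∧ t = f (traceNorm U) (traceNorm V)} (schattenNorm (1 / 2) X) := by
  constructor
  · obtain ⟨U, V, hUV, hU, hV⟩ := exists_eq_mul_transpose_traceNorm_eq_sqrt_schattenNorm_half hX
    refine ⟨U, V, hUV, ?_⟩
    rw [hU, hV, hdiag, schattenNorm_half_eq_schattenHalf, Real.sq_sqrt (schattenHalf_nonneg _)]
  · rintro t ⟨U, V, rfl, rfl⟩
    exact (schattenNorm_half_mul_transpose_le U V).trans (hf _ _)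

theorem biTraceNorm_eq_schattenNorm_half {X : Matrix (Fin m) (Fin n) ℝ} (hX : X.rank ≤ d) :
    biTraceNorm d X = schattenNorm (1 / 2) X :=
  (isLeast_schattenNorm_half hX (fun _ _ => le_rfl) fun x => (sq x).symm).csInf_eq

theorem isQuasiNormOn_biTraceNorm (m n d : ℕ) :
    IsQuasiNormOn 2 {X : Matrix (Fin m) (Fin n) ℝ | X.rank ≤ d} (biTraceNorm d) := by
  have hbi (X : Matrix (Fin m) (Fin n) ℝ) (hX : X.rank ≤ d) :
      biTraceNorm d X = schattenHalf (Matrix.toEuclideanLin X) :=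
    (biTraceNorm_eq_schattenNorm_half hX).trans (schattenNorm_half_eq_schattenHalf X)
  refine ⟨fun X hX => ?_, fun X hX => ?_, fun a X hX => ?_, fun X hX Y hY hXY => ?_⟩
  · rw [hbi X hX]
    exact schattenHalf_nonneg _
  · rw [hbi X hX, schattenHalf_eq_zero_iff, LinearEquiv.map_eq_zero_iff]
  · have haX : (a • X).rank ≤ d := by
      simpa using (Matrix.rank_mul_le_right (a • (1 : Matrix (Fin m) (Fin m) ℝ)) X).trans hX
    refine ⟨haX, ?_⟩
    rw [hbi _ haX, hbi X hX, map_smul, schattenHalf_smul, Real.norm_eq_abs]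
  · rw [hbi _ hXY, hbi X hX, hbi Y hY, map_add]
    exact schattenHalf_add_le _ _

theorem isQuasiNormOn_univ_biTraceNorm (hd : min m n ≤ d) :
    IsQuasiNormOn 2 (Set.univ : Set (Matrix (Fin m) (Fin n) ℝ)) (biTraceNorm d) := by
  have huniv : {X : Matrix (Fin m) (Fin n) ℝ | X.rank ≤ d} = Set.univ :=
    Set.eq_univ_of_forall fun X => (rank_le_min X).trans hd
  exact huniv ▸ isQuasiNormOn_biTraceNorm m n d

end Matrix

theorem theorem1_general (m n d : ℕ) :
    (min m n ≤ d →
      IsQuasiNormOn 2 (Set.univ : Set (Matrix (Fin m) (Fin n) ℝ)) (biTraceNorm d)) ∧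
    IsQuasiNormOn 2 {X : Matrix (Fin m) (Fin n) ℝ | X.rank ≤ d} (biTraceNorm d) ∧
    ∀ X : Matrix (Fin m) (Fin n) ℝ, X.rank ≤ d →
      biTraceNorm d X = schattenNorm (1 / 2) X ∧
      IsLeast {t : ℝ | ∃ (U : Matrix (Fin m) (Fin d) ℝ) (V : Matrix (Fin n) (Fin d) ℝ),
        X = U * V.transpose ∧ t = traceNorm U * traceNorm V} (biTraceNorm d X) ∧
      IsLeast {t : ℝ | ∃ (U : Matrix (Fin m) (Fin d) ℝ) (V : Matrix (Fin n) (Fin d) ℝ),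
        X = U * V.transpose ∧ t = (traceNorm U ^ 2 + traceNorm V ^ 2) / 2} (biTraceNorm d X) ∧
      IsLeast {t : ℝ | ∃ (U : Matrix (Fin m) (Fin d) ℝ) (V : Matrix (Fin n) (Fin d) ℝ),
        X = U * V.transpose ∧ t = ((traceNorm U + traceNorm V) / 2) ^ 2} (biTraceNorm d X) := by
  refine ⟨isQuasiNormOn_univ_biTraceNorm, isQuasiNormOn_biTraceNorm m n d, fun X hX => ?_⟩
  rw [biTraceNorm_eq_schattenNorm_half hX]
  exact ⟨rfl, isLeast_schattenNorm_half hX (fun _ _ => le_rfl) fun x => (sq x).symm,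
    isLeast_schattenNorm_half hX (f := fun x y => (x ^ 2 + y ^ 2) / 2)
      (fun x y => by nlinarith [sq_nonneg (x - y)]) fun x => by ring,
    isLeast_schattenNorm_half hX (f := fun x y => ((x + y) / 2) ^ 2)
      (fun x y => by nlinarith [sq_nonneg (x - y)]) fun x => by ring⟩

theorem theorem1 (m n : ℕ) :
    (∃ α : ℝ, 1 ≤ α ∧
      (∀ d : ℕ, min m n ≤ d →
        IsQuasiNormOn α (Set.univ : Set (Matrix (Fin m) (Fin n) ℝ)) (biTraceNorm d)) ∧
      (∀ d : ℕ,
        IsQuasiNormOn α {X : Matrix (Fin m) (Fin n) ℝ | X.rank ≤ d} (biTraceNorm d))) ∧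
    ∀ (d : ℕ) (X : Matrix (Fin m) (Fin n) ℝ), X.rank ≤ d →
      biTraceNorm d X = schattenNorm (1 / 2) X ∧
      IsLeast {t : ℝ | ∃ (U : Matrix (Fin m) (Fin d) ℝ) (V : Matrix (Fin n) (Fin d) ℝ),
        X = U * V.transpose ∧ t = traceNorm U * traceNorm V} (biTraceNorm d X) ∧
      IsLeast {t : ℝ | ∃ (U : Matrix (Fin m) (Fin d) ℝ) (V : Matrix (Fin n) (Fin d) ℝ),
        X = U * V.transpose ∧ t = (traceNorm U ^ 2 + traceNorm V ^ 2) / 2} (biTraceNorm d X) ∧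
      IsLeast {t : ℝ | ∃ (U : Matrix (Fin m) (Fin d) ℝ) (V : Matrix (Fin n) (Fin d) ℝ),
        X = U * V.transpose ∧ t = ((traceNorm U + traceNorm V) / 2) ^ 2} (biTraceNorm d X) :=
  ⟨⟨2, one_le_two, fun d => (theorem1_general m n d).1, fun d => (theorem1_general m n d).2.1⟩,
    fun d => (theorem1_general m n d).2.2⟩
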